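/- Let $E$ be a (real) Banach lattice and let $A\subseteq E$ be a nonempty norm bounded subset. Write $\mathrm{sol}(A)=\{y\in E: |y|\le |a| \text{ for some } a\in A\}$ for the solid hull of $A$. The set $A$ is called L-weakly compact if $\lim_{n\to\infty}\|x_n\|=0$ for every disjoint sequence $(x_n)\subset \mathrm{sol}(A)$ (disjoint means $|x_m|\wedge|x_n|=0$ for $m\neq n$). A sequence $(x_n)$ in $E$ is called uaw-null (unbounded absolutely weakly null) if $|x_n|\wedge u\to 0$ weakly for every $u\in E^+$. Then the following statements are equivalent: 1. $A$ is L-weakly compact. 2. For every uaw-null sequence $(x_n)\subset \mathrm{sol}(A)$ we have $\lim_{n\to\infty}\|x_n\|=0$. -/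

import Mathlib

open Filter Topology

/-- A sequence in a vector lattice is *disjoint* if its terms are pairwise disjoint,
`|x m| ⊓ |x n| = 0` for `m ≠ n`. -/
def IsDisjointSeq {E : Type*} [Lattice E] [AddCommGroup E] (x : ℕ → E) : Prop :=
  ∀ ⦃m n : ℕ⦄, m ≠ n → |x m| ⊓ |x n| = 0

/-- Unbounded absolute weak convergence of `x` to `a` along the filter `l`:
`|x i - a| ⊓ u` converges to zero in the weak topology of `E` for every `u ≥ 0`. -/
def UAWTendsto {ι E : Type*} [NormedAddCommGroup E] [NormedSpace ℝ E] [Lattice E]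
    (x : ι → E) (l : Filter ι) (a : E) : Prop :=
  ∀ u : E, 0 ≤ u → Tendsto (fun i => toWeakSpace ℝ E (|x i - a| ⊓ u)) l (𝓝 0)

/-- A set `A` in a Banach lattice is *L-weakly compact* if it is nonempty, norm bounded, and every
disjoint sequence in its solid hull `{y | ∃ a ∈ A, |y| ≤ |a|}` is norm null. -/
structure IsLWeaklyCompact {E : Type*} [NormedAddCommGroup E] [Lattice E] (A : Set E) : Prop where
  nonempty : A.Nonempty
  isBounded : Bornology.IsBounded A
  tendsto_norm : ∀ x : ℕ → E, (∀ n, x n ∈ LatticeOrderedAddCommGroup.solidClosure A) →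
    IsDisjointSeq x → Tendsto (fun n => ‖x n‖) atTop (𝓝 0)

theorem inf_eq_zero_of_le {E : Type*} [Lattice E] [AddCommGroup E] {a b c d : E} (ha : 0 ≤ a) (hb : 0 ≤ b) (hac : a ≤ c) (hbd : b ≤ d)
    (h : c ⊓ d = 0) : a ⊓ b = 0 :=
  le_antisymm (h ▸ inf_le_inf hac hbd) (le_inf ha hb)

theorem pairwise_disjoint_of_lt {E : Type*} [Lattice E] [AddCommGroup E] {z : ℕ → E} (h : ∀ m n, m < n → z m ⊓ z n = 0) :
    ∀ ⦃m n : ℕ⦄, m ≠ n → z m ⊓ z n = 0 := by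
  intro m n hmn
  rcases hmn.lt_or_gt with hlt | hlt
  · exact h m n hlt
  · rw [inf_comm]; exact h n m hlt

section OrderedGroup

variable {E : Type*} [AddCommGroup E] [Lattice E] [IsOrderedAddMonoid E]

theorem inf_add_le_inf_add_inf {a b c : E} (ha : 0 ≤ a) (hb : 0 ≤ b) (hc : 0 ≤ c) :
    a ⊓ (b + c) ≤ a ⊓ b + a ⊓ c := by
  rw [add_inf, inf_add, inf_add]
  refine le_inf (le_inf ?_ ?_) (le_inf ?_ inf_le_right)
  · exact inf_le_left.trans (le_add_of_nonneg_left ha)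
  · exact inf_le_left.trans (le_add_of_nonneg_left hb)
  · exact inf_le_left.trans (le_add_of_nonneg_right hc)

theorem inf_nsmul_le_nsmul_inf {a b : E} (ha : 0 ≤ a) (hb : 0 ≤ b) (n : ℕ) :
    a ⊓ n • b ≤ n • (a ⊓ b) := by
  induction n with
  | zero => simp
  | succ n ih =>
    rw [succ_nsmul, succ_nsmul]
    exact (inf_add_le_inf_add_inf ha (nsmul_nonneg hb n) hb).trans (by gcongr)

theorem inf_sum_eq_zero {ι : Type*} {a : E} (ha : 0 ≤ a) {b : ι → E} (s : Finset ι)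
    (hb : ∀ i ∈ s, 0 ≤ b i) (h : ∀ i ∈ s, a ⊓ b i = 0) : a ⊓ ∑ i ∈ s, b i = 0 := by
  classical
  induction s using Finset.induction_on with
  | empty => simpa using ha
  | insert i s hi ih =>
    have hb' : ∀ j ∈ s, 0 ≤ b j := fun j hj => hb j (Finset.mem_insert_of_mem hj)
    have hi0 := hb i (Finset.mem_insert_self i s)
    rw [Finset.sum_insert hi]
    refine le_antisymm ((inf_add_le_inf_add_inf ha hi0 (Finset.sum_nonneg hb')).trans ?_)
      (le_inf ha (add_nonneg hi0 (Finset.sum_nonneg hb')))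
    rw [h i (Finset.mem_insert_self i s),
      ih hb' fun j hj => h j (Finset.mem_insert_of_mem hj), add_zero]

theorem posPart_sub_add_inf (a b : E) : (a - b)⁺ + a ⊓ b = a := by
  rw [inf_eq_sub_posPart_sub]; abel

theorem posPart_add_le (a b : E) : (a + b)⁺ ≤ a⁺ + b⁺ :=
  sup_le (add_le_add le_sup_left le_sup_left) (add_nonneg le_sup_right le_sup_right)

theorem sum_le_of_disjoint {z : ℕ → E} (hz : ∀ n, 0 ≤ z n) {u : E} (hzu : ∀ n, z n ≤ u)
    (hdis : ∀ ⦃m n : ℕ⦄, m ≠ n → z m ⊓ z n = 0) (s : Finset ℕ) (hu : 0 ≤ u) :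
    ∑ i ∈ s, z i ≤ u := by
  induction s using Finset.induction_on with
  | empty => simpa using hu
  | insert i s hi ih =>
    rw [Finset.sum_insert hi]
    have h0 : z i ⊓ ∑ j ∈ s, z j = 0 := inf_sum_eq_zero (hz i) s (fun j _ => hz j)
      fun j hj => hdis fun h => hi (h ▸ hj)
    have h1 := inf_add_sup (z i) (∑ j ∈ s, z j)
    rw [h0, zero_add] at h1
    rw [← h1]
    exact sup_le (hzu i) ih

theorem partialSups_le_sum {y : ℕ → E} (hy : ∀ n, 0 ≤ y n) (k : ℕ) :
    partialSups y k ≤ ∑ j ∈ Finset.range (k + 1), y j :=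
  partialSups_le _ _ _ fun _ hj => Finset.single_le_sum (fun i _ => hy i)
    (Finset.mem_range.2 (Nat.lt_succ_of_le hj))

end OrderedGroup

theorem abs_sum_sign_le {E ι : Type*} [AddCommGroup E] [Lattice E]
    [IsOrderedAddMonoid E] [Module ℝ E] {z : ι → E} (hz : ∀ i, 0 ≤ z i) (ε : ι → ℝ)
    (hε : ∀ i, ε i = 1 ∨ ε i = -1) (s : Finset ι) :
    |∑ i ∈ s, ε i • z i| ≤ ∑ i ∈ s, z i := by
  have h : ∀ i, |ε i • z i| = z i := fun i => by
    rcases hε i with h | h <;> simp [h, abs_of_nonneg (hz i)]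
  classical
  induction s using Finset.induction_on with
  | empty => simp
  | insert i s hi ih =>
    rw [Finset.sum_insert hi, Finset.sum_insert hi]
    exact (abs_add_le _ _).trans (add_le_add (h i).le ih)

theorem tendsto_norm_zero_of_approx {E : Type*} [NormedAddCommGroup E] [Lattice E]
    [IsOrderedAddMonoid E] {e : ℕ → E} (h : ∀ ε > 0, ∃ v : E,
    (∀ n, ‖(e n - v)⁺‖ < ε) ∧ Tendsto (fun n => ‖e n ⊓ v‖) atTop (𝓝 0)) :
    Tendsto (fun n => ‖e n‖) atTop (𝓝 0) := by
  rw [← tendsto_zero_iff_norm_tendsto_zero, NormedAddGroup.tendsto_nhds_zero]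
  intro ε hε
  obtain ⟨v, hv, hlim⟩ := h (ε / 2) (half_pos hε)
  filter_upwards [hlim.eventually_lt_const (half_pos hε)] with n hn
  calc ‖e n‖ = ‖(e n - v)⁺ + e n ⊓ v‖ := by rw [posPart_sub_add_inf]
    _ ≤ ‖(e n - v)⁺‖ + ‖e n ⊓ v‖ := norm_add_le _ _
    _ < ε := by linarith [hv n]

section Normed

variable {E : Type*} [NormedAddCommGroup E] [Lattice E] [IsOrderedAddMonoid E] [HasSolidNorm E]

theorem norm_le_norm_of_nonneg_of_le {a b : E} (ha : 0 ≤ a) (hab : a ≤ b) : ‖a‖ ≤ ‖b‖ :=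
  norm_le_norm_of_abs_le_abs (by rwa [abs_of_nonneg ha, abs_of_nonneg (ha.trans hab)])

/-- Every disjoint sequence of positive elements of `S` is norm null. -/
def DisjointNull (S : Set E) : Prop :=
  ∀ z : ℕ → E, (∀ n, z n ∈ S) → (∀ n, 0 ≤ z n) → (∀ ⦃m n : ℕ⦄, m ≠ n → z m ⊓ z n = 0) →
    Tendsto (fun n => ‖z n‖) atTop (𝓝 0)

variable [NormedSpace ℝ E] [IsOrderedModule ℝ E] [CompleteSpace E]

/-- The gliding hump: over a bounded solid set whose disjoint sequences are norm null, the terms of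
a sequence are eventually dominated by large multiples of the sum of the preceding ones. -/
theorem exists_norm_posPart_sub_lt {S : Set E} (hS : ∀ x y, 0 ≤ x → x ≤ y → y ∈ S → x ∈ S)
    (hd : DisjointNull S) {x : ℕ → E} (hxS : ∀ n, x n ∈ S) (hx : ∀ n, 0 ≤ x n) {M : ℝ}
    (hM : ∀ n, ‖x n‖ ≤ M) {σ : ℕ → E} (hσ : ∀ m n, m < n → x m ≤ σ n) {ε : ℝ} (hε : 0 < ε) :
    ∃ n, ‖(x n - 4 ^ n • σ n)⁺‖ < ε := by
  have hsum : Summable fun n => (1 / 2 : ℝ) ^ n • x n := by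
    refine Summable.of_norm_bounded (g := fun n => (1 / 2 : ℝ) ^ n * M)
      (summable_geometric_two.mul_right M) fun n => ?_
    rw [norm_smul, norm_pow]
    norm_num
    exact hM n
  have hterm : ∀ n, 0 ≤ (1 / 2 : ℝ) ^ n • x n := fun n => smul_nonneg (by positivity) (hx n)
  set X := ∑' n, (1 / 2 : ℝ) ^ n • x n with hX
  have hle : ∀ n, (1 / 2 : ℝ) ^ n • x n ≤ X := fun n => hsum.le_tsum n fun i _ => hterm i
  have hX0 : 0 ≤ X := (hterm 0).trans (hle 0)
  have hσ0 : ∀ n, 0 ≤ 4 ^ n • σ n ∨ n = 0 := by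
    intro n
    rcases Nat.eq_zero_or_pos n with h | h
    · exact Or.inr h
    · exact Or.inl (nsmul_nonneg ((hx 0).trans (hσ 0 n h)) _)
  set v : ℕ → E := fun n =>
    if n = 0 then 0 else (x n - 4 ^ n • σ n - (1 / 2 : ℝ) ^ n • X)⁺ with hv
  have hv0 : ∀ n, 0 ≤ v n := by
    intro n; simp only [hv]; split_ifs
    · exact le_rfl
    · exact posPart_nonneg _
  have hvx : ∀ n, v n ≤ x n := by
    intro n; simp only [hv]; split_ifs with h
    · exact hx n
    · refine sup_le ?_ (hx n)
      have h1 := (hσ0 n).resolve_right h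
      have h2 : 0 ≤ (1 / 2 : ℝ) ^ n • X := smul_nonneg (by positivity) hX0
      rw [sub_sub]
      exact sub_le_self _ (add_nonneg h1 h2)
  have hdis : ∀ m n, m < n → v m ⊓ v n = 0 := by
    intro m n hmn
    have hn : n ≠ 0 := by omega
    rcases Nat.eq_zero_or_pos m with h | h
    · subst h; simpa [hv] using hv0 n
    set z := x m - (1 / 4 : ℝ) ^ n • x n with hz
    refine inf_eq_zero_of_le (hv0 m) (hv0 n) (c := z⁺) (d := 4 ^ n • z⁻) ?_ ?_ ?_
    · simp only [hv, if_neg (by omega : m ≠ 0)]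
      refine posPart_mono ?_
      have h1 := (hσ0 m).resolve_right (by omega)
      have h2 : (1 / 4 : ℝ) ^ n • x n ≤ (1 / 2 : ℝ) ^ m • X := by
        refine le_trans ?_ (smul_le_smul_of_nonneg_left (hle n) (by positivity))
        rw [smul_smul]
        refine smul_le_smul_of_nonneg_right ?_ (hx n)
        rw [show (1 / 4 : ℝ) = 1 / 2 * (1 / 2) by norm_num, mul_pow]
        gcongr ?_ * _
        exact pow_le_pow_of_le_one (by norm_num) (by norm_num) hmn.le
      exact sub_le_sub (sub_le_self _ h1) h2
    · simp only [hv, if_neg hn]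
      refine sup_le ?_ (nsmul_nonneg (negPart_nonneg _) _)
      have h3 : 4 ^ n • (-z) = x n - 4 ^ n • x m := by
        have : (4 ^ n : ℕ) • ((1 / 4 : ℝ) ^ n • x n) = x n := by
          rw [← Nat.cast_smul_eq_nsmul ℝ, smul_smul]
          push_cast
          rw [← mul_pow]; norm_num
        rw [hz, neg_sub, nsmul_sub, this]
      calc x n - 4 ^ n • σ n - (1 / 2 : ℝ) ^ n • X ≤ x n - 4 ^ n • σ n :=
            sub_le_self _ (smul_nonneg (by positivity) hX0)
        _ ≤ x n - 4 ^ n • x m := sub_le_sub_left (nsmul_le_nsmul_right (hσ m n hmn) _) _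
        _ = 4 ^ n • (-z) := h3.symm
        _ ≤ 4 ^ n • z⁻ := nsmul_le_nsmul_right (neg_le_negPart z) _
    · refine le_antisymm ((inf_nsmul_le_nsmul_inf (posPart_nonneg _) (negPart_nonneg _) _).trans ?_)
        (le_inf (posPart_nonneg _) (nsmul_nonneg (negPart_nonneg _) _))
      rw [posPart_inf_negPart_eq_zero, nsmul_zero]
  have hlim := hd v (fun n => hS _ _ (hv0 n) (hvx n) (hxS n)) hv0 (pairwise_disjoint_of_lt hdis)
  have hlim2 : Tendsto (fun n => ‖v n‖ + (1 / 2 : ℝ) ^ n * ‖X‖) atTop (𝓝 0) := by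
    have := (tendsto_pow_atTop_nhds_zero_of_lt_one (r := (1 / 2 : ℝ)) (by norm_num)
      (by norm_num)).mul_const ‖X‖
    simpa using hlim.add this
  obtain ⟨n, hn, hn1⟩ := ((hlim2.eventually_lt_const hε).and (eventually_ge_atTop 1)).exists
  refine ⟨n, lt_of_le_of_lt ?_ hn⟩
  have h1 : (x n - 4 ^ n • σ n)⁺ ≤ v n + (1 / 2 : ℝ) ^ n • X := by
    have h2 : 0 ≤ (1 / 2 : ℝ) ^ n • X := smul_nonneg (by positivity) hX0
    have h3 := posPart_add_le (x n - 4 ^ n • σ n - (1 / 2 : ℝ) ^ n • X) ((1 / 2 : ℝ) ^ n • X)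
    rw [sub_add_cancel, posPart_eq_self.2 h2] at h3
    simpa only [hv, if_neg (by omega : n ≠ 0)] using h3
  refine (norm_le_norm_of_nonneg_of_le (posPart_nonneg _) h1).trans ((norm_add_le _ _).trans ?_)
  rw [norm_smul, norm_pow]
  norm_num

/-- Elements of `T` are approximated from below, uniformly in norm, by sums of elements of `T`. -/
theorem exists_mem_closure_norm_posPart_sub_lt {S T : Set E}
    (hS : ∀ x y, 0 ≤ x → x ≤ y → y ∈ S → x ∈ S) (hd : DisjointNull S) {M : ℝ}
    (hTS : T ⊆ S) (hT0 : ∀ x ∈ T, 0 ≤ x) (hM : ∀ x ∈ T, ‖x‖ ≤ M) {ε : ℝ} (hε : 0 < ε) :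
    ∃ v ∈ AddSubmonoid.closure T, ∀ x ∈ T, ‖(x - v)⁺‖ < ε := by
  by_contra! hcon
  choose! g hgT hg using hcon
  let τ : ℕ → E := fun n => Nat.rec 0 (fun n s => s + g (4 ^ n • s)) n
  have hτ : ∀ n, τ (n + 1) = τ n + g (4 ^ n • τ n) := fun n => rfl
  have hτmem : ∀ n, τ n ∈ AddSubmonoid.closure T := by
    intro n
    induction n with
    | zero => exact zero_mem _
    | succ n ih =>
      rw [hτ]
      exact add_mem ih (AddSubmonoid.subset_closure (hgT _ (nsmul_mem ih _)))
  have hgT' : ∀ n, g (4 ^ n • τ n) ∈ T := fun n => hgT _ (nsmul_mem (hτmem n) _)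
  have hmono : Monotone τ := monotone_nat_of_le_succ fun n => by
    rw [hτ]; exact le_add_of_nonneg_right (hT0 _ (hgT' n))
  obtain ⟨n, hn⟩ := exists_norm_posPart_sub_lt hS hd (x := fun n => g (4 ^ n • τ n))
    (fun n => hTS (hgT' n)) (fun n => hT0 _ (hgT' n)) (fun n => hM _ (hgT' n)) (σ := τ)
    (fun m n hmn => by
      refine le_trans ?_ (hmono (Nat.succ_le_of_lt hmn))
      rw [Nat.succ_eq_add_one, hτ]
      exact le_add_of_nonneg_left (hmono (Nat.zero_le m))) hε
  exact absurd (hg _ (nsmul_mem (hτmem n) _)) (not_le.2 hn)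

end Normed

section Multiplicity

variable {E : Type*} [NormedAddCommGroup E] [Lattice E] [IsOrderedAddMonoid E] [HasSolidNorm E]

theorem norm_le_of_mem_Icc {u x : E} (hx : x ∈ Set.Icc 0 u) : ‖x‖ ≤ ‖u‖ :=
  norm_le_norm_of_nonneg_of_le hx.1 hx.2

theorem tendsto_norm_inf_of_mem_closure {T : Set E} (hT : ∀ t ∈ T, 0 ≤ t) {e : ℕ → E}
    (he : ∀ n, 0 ≤ e n) (h : ∀ t ∈ T, Tendsto (fun n => ‖e n ⊓ t‖) atTop (𝓝 0)) {v : E}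
    (hv : v ∈ AddSubmonoid.closure T) :
    0 ≤ v ∧ Tendsto (fun n => ‖e n ⊓ v‖) atTop (𝓝 0) := by
  induction hv using AddSubmonoid.closure_induction with
  | mem t ht => exact ⟨hT t ht, h t ht⟩
  | zero => exact ⟨le_rfl, by simp [inf_eq_right.2 (he _)]⟩
  | add v w _ _ hv hw =>
    refine ⟨add_nonneg hv.1 hw.1, ?_⟩
    refine squeeze_zero (fun _ => norm_nonneg _) (fun n => ?_) (by simpa using hv.2.add hw.2)
    exact (norm_le_norm_of_nonneg_of_le (le_inf (he n) (add_nonneg hv.1 hw.1))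
      (inf_add_le_inf_add_inf (he n) hv.1 hw.1)).trans (norm_add_le _ _)

theorem DisjointNull.Icc_of_mem_closure {S : Set E}
    (hS : ∀ x y, 0 ≤ x → x ≤ y → y ∈ S → x ∈ S) (hd : DisjointNull S) (hS0 : ∀ x ∈ S, 0 ≤ x)
    {u : E} (hu : u ∈ AddSubmonoid.closure S) : DisjointNull (Set.Icc 0 u) := by
  intro z hz hz0 hdis
  have := (tendsto_norm_inf_of_mem_closure hS0 hz0 (fun t ht => hd (fun n => z n ⊓ t)
    (fun n => hS _ _ (le_inf (hz0 n) (hS0 t ht)) inf_le_right ht)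
    (fun n => le_inf (hz0 n) (hS0 t ht)) fun m n hmn => inf_eq_zero_of_le
      (le_inf (hz0 m) (hS0 t ht)) (le_inf (hz0 n) (hS0 t ht)) inf_le_left inf_le_left
      (hdis hmn)) hu).2
  simpa only [inf_eq_left.2 (hz _).2] using this

variable [NormedSpace ℝ E] [IsOrderedModule ℝ E]

/-- Every positive element is normed by a positive functional of norm at most one. -/
theorem exists_positive_functional {y : E} (hy : 0 ≤ y) :
    ∃ f : E →L[ℝ] ℝ, (∀ x, 0 ≤ x → 0 ≤ f x) ∧ (∀ x, f x ≤ ‖x‖) ∧ f y = ‖y‖ := by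
  rcases eq_or_ne y 0 with rfl | hy0
  · exact ⟨0, by simp, by simp, by simp⟩
  have hsmul : ∀ c : ℝ, 0 ≤ c → ∀ x : E, (c • x)⁺ ≤ c • x⁺ := fun c hc x =>
    sup_le (smul_le_smul_of_nonneg_left (le_posPart x) hc) (smul_nonneg hc (posPart_nonneg x))
  have hsmul' : ∀ c : ℝ, 0 < c → ∀ x : E, (c • x)⁺ = c • x⁺ := fun c hc x => by
    refine le_antisymm (hsmul c hc.le x) ?_
    have h := smul_le_smul_of_nonneg_left (hsmul c⁻¹ (inv_nonneg.2 hc.le) (c • x)) hc.le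
    rwa [smul_smul, inv_mul_cancel₀ hc.ne', one_smul, smul_smul, mul_inv_cancel₀ hc.ne',
      one_smul] at h
  have hpos : ∀ x : E, ‖x⁺‖ ≤ ‖x‖ := fun x => norm_le_norm_of_abs_le_abs <| by
    rw [abs_of_nonneg (posPart_nonneg x)]; exact sup_le (le_abs_self x) (abs_nonneg x)
  obtain ⟨g, hg, hgN⟩ := exists_extension_of_le_sublinear
    (LinearPMap.mkSpanSingleton (K := ℝ) y ‖y‖ hy0) (fun x => ‖x⁺‖)
    (fun c hc x => by
      show ‖(c • x)⁺‖ = c * ‖x⁺‖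
      rw [hsmul' c hc, norm_smul, Real.norm_of_nonneg hc.le])
    (fun a b => (norm_le_norm_of_nonneg_of_le (posPart_nonneg _) (posPart_add_le a b)).trans
      (norm_add_le _ _))
    (by
      rintro ⟨x, hx⟩
      obtain ⟨c, rfl⟩ := Submodule.mem_span_singleton.1 hx
      rw [LinearPMap.mkSpanSingleton'_apply, RingHom.id_apply, smul_eq_mul]
      rcases le_or_gt c 0 with hc | hc
      · exact (mul_nonpos_of_nonpos_of_nonneg hc (norm_nonneg y)).trans (norm_nonneg _)
      · show c * ‖y‖ ≤ ‖(c • y)⁺‖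
        rw [hsmul' c hc, norm_smul, Real.norm_of_nonneg hc.le, posPart_eq_self.2 hy])
  have hle : ∀ x, g x ≤ ‖x‖ := fun x => (hgN x).trans (hpos x)
  refine ⟨g.mkContinuous 1 fun x => ?_, fun x hx => ?_, hle, ?_⟩
  · rw [one_mul, Real.norm_eq_abs, abs_le]
    refine ⟨?_, hle x⟩
    have := hle (-x)
    rw [map_neg, norm_neg] at this
    linarith
  · have h := hgN (-x)
    rw [posPart_eq_zero.2 (neg_nonpos.2 hx), norm_zero, map_neg] at h
    show 0 ≤ g x
    linarith
  · have := hg ⟨y, Submodule.mem_span_singleton_self y⟩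
    rw [LinearPMap.mkSpanSingleton_apply] at this
    exact this

variable [CompleteSpace E]

/-- A sequence for which any `K + 1` terms have no common positive lower bound is norm null. -/
theorem DisjointNull.tendsto_of_multiplicity {S : Set E}
    (hS : ∀ x y, 0 ≤ x → x ≤ y → y ∈ S → x ∈ S) (hd : DisjointNull S) {M : ℝ}
    (hM : ∀ x ∈ S, ‖x‖ ≤ M) (K : ℕ) {e : ℕ → E} (heS : ∀ n, e n ∈ S) (he : ∀ n, 0 ≤ e n)
    (hK : ∀ s : Finset ℕ, s.card = K + 1 → ∀ z, (∀ i ∈ s, z ≤ e i) → z ≤ 0) :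
    Tendsto (fun n => ‖e n‖) atTop (𝓝 0) := by
  induction K generalizing e with
  | zero =>
    have : ∀ n, e n = 0 := fun n => le_antisymm (hK {n} (by simp) _ (by simp)) (he n)
    simp [this]
  | succ K ih =>
    refine tendsto_norm_zero_of_approx fun ε hε => ?_
    have hT0 : ∀ x ∈ Set.range e, 0 ≤ x := by rintro _ ⟨n, rfl⟩; exact he n
    have hTS : Set.range e ⊆ S := by rintro _ ⟨n, rfl⟩; exact heS n
    obtain ⟨v, hv, hlt⟩ := exists_mem_closure_norm_posPart_sub_lt hS hd hTS hT0
      (fun x hx => hM x (hTS hx)) hε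
    refine ⟨v, fun n => hlt _ ⟨n, rfl⟩, (tendsto_norm_inf_of_mem_closure hT0 he ?_ hv).2⟩
    rintro _ ⟨i, rfl⟩
    rw [← tendsto_add_atTop_iff_nat (i + 1)]
    refine ih (e := fun n => e (n + (i + 1)) ⊓ e i)
      (fun n => hS _ _ (le_inf (he _) (he _)) inf_le_right (heS i))
      (fun n => le_inf (he _) (he _)) fun s hs z hz => ?_
    refine hK (insert i (s.map (addRightEmbedding (i + 1)))) ?_ z fun j hj => ?_
    · rw [Finset.card_insert_of_notMem, Finset.card_map, hs]
      simp only [Finset.mem_map, addRightEmbedding_apply, not_exists, not_and]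
      intro a _; omega
    · rcases Finset.mem_insert.1 hj with rfl | hj
      · obtain ⟨a, ha⟩ : s.Nonempty := Finset.card_pos.1 (by omega)
        exact (hz a ha).trans inf_le_right
      · obtain ⟨a, ha, rfl⟩ := Finset.mem_map.1 hj
        exact (hz a ha).trans inf_le_left

theorem DisjointNull.tendsto_of_sum_le {u : E} (hd : DisjointNull (Set.Icc 0 u)) {d : ℕ → E}
    (hd0 : ∀ n, 0 ≤ d n) (hsum : ∀ s : Finset ℕ, ∑ i ∈ s, d i ≤ u) :
    Tendsto (fun n => ‖d n‖) atTop (𝓝 0) := by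
  have hu : 0 ≤ u := by simpa using hsum ∅
  have hdu : ∀ n, d n ≤ u := fun n => by simpa using hsum {n}
  have hS : ∀ x y : E, 0 ≤ x → x ≤ y → y ∈ Set.Icc 0 u → x ∈ Set.Icc 0 u :=
    fun x y hx hxy hy => ⟨hx, hxy.trans hy.2⟩
  rw [← tendsto_zero_iff_norm_tendsto_zero, NormedAddGroup.tendsto_nhds_zero]
  intro ε hε
  set η : ℝ := ε / 2 / (‖u‖ + 1) with hη
  have hη0 : 0 < η := by positivity
  have hηu0 : 0 ≤ η • u := smul_nonneg hη0.le hu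
  have hηu : η * ‖u‖ ≤ ε / 2 := by
    rw [hη, div_mul_eq_mul_div, div_le_iff₀ (by positivity)]
    nlinarith [norm_nonneg u]
  obtain ⟨K, hK⟩ := exists_nat_ge (2 / η)
  have hK2 : 2 ≤ (K + 1 : ℝ) * η := by
    rw [div_le_iff₀ hη0] at hK; linarith
  have hed : ∀ n, (d n - η • u)⁺ ≤ d n := fun n => sup_le (sub_le_self _ hηu0) (hd0 n)
  have hlim : Tendsto (fun n => ‖(d n - η • u)⁺‖) atTop (𝓝 0) := by
    refine hd.tendsto_of_multiplicity hS (fun x hx => norm_le_of_mem_Icc hx) K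
      (fun n => ⟨posPart_nonneg _, (hed n).trans (hdu n)⟩) (fun n => posPart_nonneg _) ?_
    intro s hs z hz
    have hz' : ∀ i ∈ s, z⁺ ≤ (d i - η • u)⁺ := fun i hi => sup_le (hz i hi) (posPart_nonneg _)
    have h1 : z⁺ ⊓ ∑ i ∈ s, (d i - η • u)⁻ = 0 :=
      inf_sum_eq_zero (posPart_nonneg _) s (fun i _ => negPart_nonneg _) fun i hi =>
        inf_eq_zero_of_le (posPart_nonneg _) (negPart_nonneg _) (hz' i hi) le_rfl
          (posPart_inf_negPart_eq_zero _)
    have h2 : u ≤ ∑ i ∈ s, (d i - η • u)⁻ := by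
      calc u = (2 : ℝ) • u - u := by rw [two_smul]; abel
        _ ≤ ((K + 1 : ℝ) * η) • u - ∑ i ∈ s, d i :=
            sub_le_sub (smul_le_smul_of_nonneg_right hK2 hu) (hsum s)
        _ = ∑ i ∈ s, -(d i - η • u) := by
            simp only [neg_sub, Finset.sum_sub_distrib, Finset.sum_const, hs, mul_smul]
            rw [← Nat.cast_smul_eq_nsmul ℝ]
            push_cast
            rfl
        _ ≤ _ := Finset.sum_le_sum fun i _ => neg_le_negPart _
    obtain ⟨i, hi⟩ : s.Nonempty := Finset.card_pos.1 (by omega)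
    rw [inf_eq_left.2 ((hz' i hi).trans ((hed i).trans ((hdu i).trans h2)))] at h1
    exact posPart_eq_zero.1 h1
  filter_upwards [hlim.eventually_lt_const (half_pos hε)] with n hn
  have h3 : d n ≤ (d n - η • u)⁺ + η • u := by
    rw [← sub_le_iff_le_add]; exact le_posPart _
  calc ‖d n‖ ≤ ‖(d n - η • u)⁺ + η • u‖ := norm_le_norm_of_nonneg_of_le (hd0 n) h3
    _ ≤ ‖(d n - η • u)⁺‖ + ‖η • u‖ := norm_add_le _ _
    _ < ε := by rw [norm_smul, Real.norm_of_nonneg hη0.le]; linarith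

/-- Order bounded increasing sequences converge in norm if order bounded disjoint sequences are
norm null. -/
theorem DisjointNull.cauchySeq_of_monotone {u : E} (hd : DisjointNull (Set.Icc 0 u)) {w : ℕ → E}
    (hw : Monotone w) (hwu : ∀ n, w n ∈ Set.Icc 0 u) : CauchySeq w := by
  rw [Metric.cauchySeq_iff']
  by_contra! hcon
  obtain ⟨ε, hε, hcon⟩ := hcon
  choose g hgn hg using hcon
  let N : ℕ → ℕ := fun k => Nat.rec 0 (fun _ m => g m) k
  have hN : Monotone N := monotone_nat_of_le_succ fun n => hgn (N n)
  have hd0 : ∀ n, 0 ≤ w (N (n + 1)) - w (N n) := fun n => sub_nonneg.2 (hw (hN (Nat.le_succ n)))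
  have hlim := hd.tendsto_of_sum_le (d := fun n => w (N (n + 1)) - w (N n)) hd0 fun s => by
    obtain ⟨m, hm⟩ := s.exists_nat_subset_range
    refine (Finset.sum_le_sum_of_subset_of_nonneg hm fun i _ _ => hd0 i).trans ?_
    rw [Finset.sum_range_sub fun n => w (N n)]
    exact (sub_le_self _ (hwu _).1).trans (hwu _).2
  obtain ⟨n, hn⟩ := (hlim.eventually_lt_const hε).exists
  have := hg (N n)
  rw [dist_eq_norm] at this
  exact absurd hn (not_lt.2 this)

end Multiplicity

section WeaklyNull

variable {E : Type*} [NormedAddCommGroup E] [Lattice E] [NormedSpace ℝ E]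

theorem tendsto_toWeakSpace_zero_iff {E ι : Type*} [NormedAddCommGroup E] [NormedSpace ℝ E]
    {l : Filter ι} {y : ι → E} :
    Tendsto (fun i => toWeakSpace ℝ E (y i)) l (𝓝 0) ↔
      ∀ f : E →L[ℝ] ℝ, Tendsto (fun i => f (y i)) l (𝓝 0) := by
  have hB : Function.Injective (topDualPairing ℝ E).flip := fun a b hab =>
    SeparatingDual.eq_iff_forall_dual_eq (R := ℝ) |>.2 fun f => LinearMap.congr_fun hab f
  have h := WeakBilin.tendsto_iff_forall_eval_tendsto (B := (topDualPairing ℝ E).flip) (l := l)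
    (f := fun i => toWeakSpace ℝ E (y i)) (x := 0) hB
  refine h.trans (forall_congr' fun f => ?_)
  change Tendsto _ l (𝓝 (f (0 : E))) ↔ _
  rw [map_zero]
  rfl

variable [IsOrderedAddMonoid E] [HasSolidNorm E]

/-- Order bounded disjoint sequences are weakly null. -/
theorem tendsto_dual_of_disjoint {z : ℕ → E} (hz : ∀ n, 0 ≤ z n) {u : E} (hzu : ∀ n, z n ≤ u)
    (hdis : ∀ ⦃m n : ℕ⦄, m ≠ n → z m ⊓ z n = 0) (f : E →L[ℝ] ℝ) :
    Tendsto (fun n => f (z n)) atTop (𝓝 0) := by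
  have hu : 0 ≤ u := (hz 0).trans (hzu 0)
  have hsum : Summable fun n => |f (z n)| := by
    refine summable_of_sum_le (c := ‖f‖ * ‖u‖) (fun _ => abs_nonneg _) fun s => ?_
    let ε : ℕ → ℝ := fun n => if 0 ≤ f (z n) then 1 else -1
    have hε : ∀ n, ε n = 1 ∨ ε n = -1 := fun n => by simp only [ε]; split_ifs <;> simp
    have hεf : ∀ n, |f (z n)| = f (ε n • z n) := fun n => by
      simp only [ε]
      split_ifs with h
      · rw [one_smul, abs_of_nonneg h]
      · rw [neg_smul, one_smul, map_neg, abs_of_neg (not_le.1 h)]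
    calc ∑ i ∈ s, |f (z i)| = f (∑ i ∈ s, ε i • z i) := by
          rw [map_sum]; exact Finset.sum_congr rfl fun i _ => hεf i
      _ ≤ ‖f (∑ i ∈ s, ε i • z i)‖ := Real.le_norm_self _
      _ ≤ ‖f‖ * ‖∑ i ∈ s, ε i • z i‖ := f.le_opNorm _
      _ ≤ ‖f‖ * ‖u‖ := by
          gcongr
          refine norm_le_norm_of_abs_le_abs ?_
          rw [abs_of_nonneg hu]
          exact (abs_sum_sign_le hz ε hε s).trans (sum_le_of_disjoint hz hzu hdis s hu)
  exact (tendsto_zero_iff_abs_tendsto_zero _).2 hsum.tendsto_atTop_zero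

variable [IsOrderedModule ℝ E] [CompleteSpace E]

theorem DisjointNull.exists_norm_lt {u : E} (hd : DisjointNull (Set.Icc 0 u)) {y : ℕ → E}
    (hy : ∀ n, y n ∈ Set.Icc 0 u) (hw : ∀ f : E →L[ℝ] ℝ, Tendsto (fun n => f (y n)) atTop (𝓝 0))
    {δ : ℝ} (hδ : 0 < δ) : ∃ n, ‖y n‖ < δ := by
  by_contra! hcon
  choose F hF0 hFn hFy using fun n => exists_positive_functional (hy n).1
  obtain ⟨φ, hφ, hφF⟩ := extraction_forall_of_eventually
    (P := fun n k => ∀ i ∈ Finset.range (n + 1), F i (y k) < (1 / 2 : ℝ) ^ n) fun n =>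
      (Finset.eventually_all _).2 fun i _ => (hw (F i)).eventually_lt_const (by positivity)
  have hmono : ∀ (f : E →L[ℝ] ℝ), (∀ x, 0 ≤ x → 0 ≤ f x) → ∀ a b, a ≤ b → f a ≤ f b :=
    fun f hf a b hab => by simpa using hf (b - a) (sub_nonneg.2 hab)
  let W : ℕ → ℕ → E := fun m k => partialSups (fun j => y (φ (m + j))) k
  have hWle : ∀ m k, W m k ≤ u := fun m k => partialSups_le _ _ _ fun j _ => (hy _).2
  have hleW : ∀ m j k, j ≤ k → y (φ (m + j)) ≤ W m k := fun m j k hjk =>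
    le_partialSups_of_le (fun j => y (φ (m + j))) hjk
  have hWmono : ∀ m, Monotone (W m) := fun m => (partialSups fun j => y (φ (m + j))).monotone
  have hW0 : ∀ m k, 0 ≤ W m k := fun m k => (hy _).1.trans (hleW m 0 k (Nat.zero_le k))
  choose w hWw using fun m => cauchySeq_tendsto_of_complete
    (hd.cauchySeq_of_monotone (hWmono m) fun k => ⟨hW0 m k, hWle m k⟩)
  have hWlew : ∀ m k, W m k ≤ w m := fun m k => (hWmono m).ge_of_tendsto (hWw m) k
  have hwu : ∀ m, w m ≤ u := fun m => le_of_tendsto' (hWw m) (hWle m)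
  have hw0 : ∀ m, 0 ≤ w m := fun m => (hW0 m 0).trans (hWlew m 0)
  have hanti : ∀ m, w (m + 1) ≤ w m := fun m => le_of_tendsto' (hWw (m + 1)) fun k =>
    (partialSups_le _ _ _ fun j hj => by
      have := hleW m (1 + j) (k + 1) (by omega)
      rwa [← add_assoc] at this).trans (hWlew m (k + 1))
  have hcau := hd.cauchySeq_of_monotone (w := fun m => u - w m)
    (monotone_nat_of_le_succ fun m => sub_le_sub_left (hanti m) u)
    fun m => ⟨sub_nonneg.2 (hwu m), sub_le_self _ (hw0 m)⟩
  obtain ⟨v, hv⟩ := cauchySeq_tendsto_of_complete hcau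
  have hwlim : Tendsto w atTop (𝓝 (u - v)) := by
    simpa using (tendsto_const_nhds (x := u)).sub hv
  have hle : ∀ m, u - v ≤ w m := fun m =>
    (antitone_nat_of_succ_le hanti).le_of_tendsto hwlim m
  have hbound : ∀ i m, i ≤ m → F i (w m) ≤ (1 / 2 : ℝ) ^ m * 2 := by
    intro i m him
    refine le_of_tendsto' (((F i).continuous.tendsto _).comp (hWw m)) fun k => ?_
    calc F i (W m k) ≤ F i (∑ j ∈ Finset.range (k + 1), y (φ (m + j))) :=
          hmono _ (hF0 i) _ _ (partialSups_le_sum (fun j => (hy _).1) k)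
      _ = ∑ j ∈ Finset.range (k + 1), F i (y (φ (m + j))) := map_sum _ _ _
      _ ≤ ∑ j ∈ Finset.range (k + 1), (1 / 2 : ℝ) ^ m * (1 / 2 : ℝ) ^ j :=
          Finset.sum_le_sum fun j _ => by
            rw [← pow_add]
            exact (hφF (m + j) i (Finset.mem_range.2 (by omega))).le
      _ = (1 / 2 : ℝ) ^ m * ∑ j ∈ Finset.range (k + 1), (1 / 2 : ℝ) ^ j := by
          rw [Finset.mul_sum]
      _ ≤ (1 / 2 : ℝ) ^ m * 2 := by
          gcongr
          exact sum_geometric_two_le _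
  have hnonpos : ∀ i, F i (u - v) ≤ 0 := fun i => by
    have hlim : Tendsto (fun m => (1 / 2 : ℝ) ^ m * 2) atTop (𝓝 0) := by
      simpa using (tendsto_pow_atTop_nhds_zero_of_lt_one (r := (1 / 2 : ℝ)) (by norm_num)
        (by norm_num)).mul_const 2
    refine ge_of_tendsto hlim ?_
    filter_upwards [eventually_ge_atTop i] with m hm
    exact (hmono _ (hF0 i) _ _ (hle m)).trans (hbound i m hm)
  obtain ⟨n, hn⟩ := ((tendsto_iff_norm_sub_tendsto_zero.1 hwlim).eventually_lt_const hδ).exists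
  have h1 : δ ≤ F (φ n) (w n) := by
    refine (hcon (φ n)).trans ((hFy (φ n)).symm.le.trans (hmono _ (hF0 _) _ _ ?_))
    exact (hleW n 0 0 le_rfl).trans (hWlew n 0)
  have h2 := hFn (φ n) (w n - (u - v))
  rw [map_sub] at h2
  linarith [hnonpos (φ n)]

/-- Weakly null sequences in an order interval whose disjoint sequences are norm null are norm
null. -/
theorem DisjointNull.tendsto_of_weaklyNull {u : E} (hd : DisjointNull (Set.Icc 0 u)) {y : ℕ → E}
    (hy : ∀ n, y n ∈ Set.Icc 0 u)
    (hw : ∀ f : E →L[ℝ] ℝ, Tendsto (fun n => f (y n)) atTop (𝓝 0)) :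
    Tendsto (fun n => ‖y n‖) atTop (𝓝 0) := by
  rw [← tendsto_zero_iff_norm_tendsto_zero, NormedAddGroup.tendsto_nhds_zero]
  intro δ hδ
  by_contra hcon
  obtain ⟨φ, hφ, hφy⟩ := extraction_of_frequently_atTop (not_eventually.1 hcon)
  obtain ⟨n, hn⟩ := hd.exists_norm_lt (fun n => hy (φ n))
    (fun f => (hw f).comp hφ.tendsto_atTop) hδ
  exact hφy n hn

end WeaklyNull

theorem mainTheorem2 {E : Type*} [NormedAddCommGroup E] [NormedSpace ℝ E] [Lattice E]
    [IsOrderedAddMonoid E] [IsOrderedModule ℝ E] [HasSolidNorm E] [CompleteSpace E]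
    (A : Set E) (hne : A.Nonempty) (hA : Bornology.IsBounded A) :
    IsLWeaklyCompact A ↔
      ∀ x : ℕ → E, (∀ n, x n ∈ LatticeOrderedAddCommGroup.solidClosure A) →
        UAWTendsto x atTop 0 → Tendsto (fun n => ‖x n‖) atTop (𝓝 0) := by
  constructor
  · intro hL x hx hux
    set S : Set E := {y | 0 ≤ y ∧ y ∈ LatticeOrderedAddCommGroup.solidClosure A} with hSdef
    have hS : ∀ x y, 0 ≤ x → x ≤ y → y ∈ S → x ∈ S := by
      rintro x y hx hxy ⟨hy, a, ha, hya⟩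
      refine ⟨hx, a, ha, ?_⟩
      rw [abs_of_nonneg hx]
      rw [abs_of_nonneg hy] at hya
      exact hxy.trans hya
    have hd : DisjointNull S := fun z hz hz0 hdis => hL.tendsto_norm z (fun n => (hz n).2)
      fun m n hmn => by simpa only [abs_of_nonneg (hz0 _)] using hdis hmn
    obtain ⟨M, hM⟩ := hA.exists_norm_le
    have hSM : ∀ y ∈ S, ‖y‖ ≤ M := by
      rintro y ⟨-, a, ha, hya⟩
      exact (norm_le_norm_of_abs_le_abs hya).trans (hM a ha)
    have hxS : ∀ n, |x n| ∈ S := fun n => by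
      obtain ⟨a, ha, hxa⟩ := hx n
      exact ⟨abs_nonneg _, a, ha, by rwa [abs_abs]⟩
    have key : Tendsto (fun n => ‖|x n|‖) atTop (𝓝 0) := by
      refine tendsto_norm_zero_of_approx fun ε hε => ?_
      obtain ⟨v, hv, hlt⟩ := exists_mem_closure_norm_posPart_sub_lt hS hd subset_rfl
        (fun y hy => hy.1) hSM hε
      have hv0 : 0 ≤ v := (AddSubmonoid.closure_le (S := AddSubmonoid.nonneg E)).2
        (fun y hy => hy.1) hv
      refine ⟨v, fun n => hlt _ (hxS n),
        (hd.Icc_of_mem_closure hS (fun y hy => hy.1) hv).tendsto_of_weaklyNull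
          (fun n => ⟨le_inf (abs_nonneg _) hv0, inf_le_right⟩) ?_⟩
      have := hux v hv0
      simp only [sub_zero] at this
      exact tendsto_toWeakSpace_zero_iff.1 this
    simpa only [norm_abs_eq_norm] using key
  · intro h
    refine ⟨hne, hA, fun x hx hdis => h x hx fun u hu => ?_⟩
    simp only [sub_zero]
    have h0 : ∀ n, 0 ≤ |x n| ⊓ u := fun n => le_inf (abs_nonneg _) hu
    exact tendsto_toWeakSpace_zero_iff.2 (tendsto_dual_of_disjoint h0 (fun n => inf_le_right)
      fun m n hmn => inf_eq_zero_of_le (h0 m) (h0 n) inf_le_left inf_le_left (hdis hmn))
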